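/- Consider the basic machine activation problem on unrelated machines: there are a finite set $M$ of $m$ machines and a finite set $J$ of $n$ jobs, machine $i$ has activation cost $a_i\ge 0$, and job $j$ takes time $p_{i,j}\in[0,\infty]$ on machine $i$. A schedule is a set $S\subseteq M$ of activated machines with an assignment of every job to a machine of $S$; its activation cost is $\sum_{i\in S}a_i$, and its makespan is the largest total processing time assigned to one machine. Let $T\in[0,\infty)$ be given. For $S\subseteq M$ let $f(S)$ be the value of the linear program $$\mathrm{LP}(S):\quad \max\sum_{i,j}x_{i,j}\quad\text{s.t.}\quad \sum_i x_{i,j}\le 1\ (j\in J),\quad \sum_j p_{i,j}x_{i,j}\le T\ (i\in S),\quad x\ge 0,$$ with $x_{i,j}=0$ whenever $i\notin S$ or $p_{i,j}>T$. The greedy algorithm starts with $S=\emptyset$. While $f(S)\le n-1$, it solves $\mathrm{LP}(S\cup\{i\})$ for every $i\in M\setminus S$ and adds to $S$ a machine $i$ that maximizes $\bigl(f(S\cup\{i\})-f(S)\bigr)/a_i$ and has $f(S\cup\{i\})>f(S)$ (a positive gain at cost $0$ counts as ratio $\infty$, a zero gain as ratio $0$; ties are broken arbitrarily). When $f(S)>n-1$,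 it takes an optimal solution $x$ of $\mathrm{LP}(S)$ and rounds it: for each machine $i$ the jobs are sorted by non-increasing $p_{i,j}$, the pieces of length $x_{i,j}$ are laid out consecutively in this order from $0$ on a half-line that is cut into unit slots, job $j$ is joined to every slot of machine $i$ that its piece overlaps in positive length, all jobs are matched to distinct slots, and each job is assigned to the machine of its slot. The output is the set $S$ with this assignment. Suppose that there is a schedule with makespan at most $T$ and activation cost at most $A$. Then the greedy algorithm is a $(2,1+\ln n)$-approximation. That is: however ties are broken, 1. the algorithm never gets stuck (as long as $f(S)\le n-1$, some machine can be added); it makes at most $\min(m,n)$ greedy steps, the $i$-th of which ($i=1,2,\dots$) solves $m-i+1$ linear programs; and when it stops, every optimal solution of $\mathrm{LP}(S)$, with every such sorting of the jobs, can be rounded as described; in particular it produces an output; 2. every schedule that it can output has makespan at most $2T$ and activation cost at most $A(1+\ln n)$ (for $n=0$ the convention $\ln 0=0$ is used). -/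

import Mathlib

open scoped NNReal ENNReal

namespace MachineActivation

/-- An instance of machine activation on unrelated machines: `p i j` is the processing time of job
`j` on machine `i` (`∞` if `i` cannot process `j`), `a i` is the activation cost of machine `i`. -/
structure Problem (M J : Type*) where
  p : M → J → ℝ≥0∞
  a : M → ℝ≥0

/-- A schedule: a set of activated machines, and an assignment of every job to one of them. -/
structure Schedule (M J : Type*) where
  active : Finset M
  assign : J → M
  assign_mem : ∀ j, assign j ∈ active

variable {M J : Type*} [Fintype M] [Fintype J]

/-- Total processing time of the jobs assigned to machine `i`. -/
noncomputable def Schedule.load [DecidableEq M] (s : Schedule M J) (I : Problem M J) (i : M) : ℝ≥0∞ :=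
  ∑ j with s.assign j = i, I.p i j

/-- The time at which all jobs are complete. -/
noncomputable def Schedule.makespan [DecidableEq M] (s : Schedule M J) (I : Problem M J) : ℝ≥0∞ :=
  ⨆ i, s.load I i

/-- Total activation cost of the activated machines (whether or not they receive a job). -/
noncomputable def Schedule.cost (s : Schedule M J) (I : Problem M J) : ℝ :=
  ∑ i ∈ s.active, (I.a i : ℝ)

/-! ### The linear program for a set of active machines -/

/-- The feasible region of the linear program `LP(S)`: fractional assignments of (parts of) jobs to
the machines in `S`, each of which is available for `T` time units; a job is not assigned at all to
a machine on which it takes longer than `T`.  (So `toReal` is only ever applied to finite values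
with a nonzero coefficient.) -/
structure Feasible (I : Problem M J) (T : ℝ≥0) (S : Finset M) (x : M → J → ℝ) : Prop where
  nonneg : ∀ i j, 0 ≤ x i j
  inactive : ∀ i j, i ∉ S → x i j = 0
  too_long : ∀ i j, (T : ℝ≥0∞) < I.p i j → x i j = 0
  job : ∀ j, ∑ i, x i j ≤ 1
  machine : ∀ i, ∑ j, (I.p i j).toReal * x i j ≤ T

/-- The objective of `LP(S)`: the (fractional) number of jobs that are processed. -/
noncomputable def amount (x : M → J → ℝ) : ℝ := ∑ i, ∑ j, x i j

/-- `x` is an optimal solution of `LP(S)`. -/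
def IsOptimal (I : Problem M J) (T : ℝ≥0) (S : Finset M) (x : M → J → ℝ) : Prop :=
  Feasible I T S x ∧ ∀ y, Feasible I T S y → amount y ≤ amount x

/-- The optimal value of `LP(S)`. -/
noncomputable def lpValue (I : Problem M J) (T : ℝ≥0) (S : Finset M) : ℝ :=
  sSup {v | ∃ x, Feasible I T S x ∧ v = amount x}

/-- `LP(S)` has an optimal solution. -/
theorem exists_isOptimal (I : Problem M J) (T : ℝ≥0) (S : Finset M) : ∃ x, IsOptimal I T S x := by
  have hle : ∀ x : M → J → ℝ, Feasible I T S x → ∀ i j, x i j ≤ 1 := fun x hx i j =>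
    (Finset.single_le_sum (f := fun i => x i j) (fun i _ => hx.nonneg i j)
      (Finset.mem_univ i)).trans (hx.job j)
  have hset : {x | Feasible I T S x} =
      (⋂ i, ⋂ j, {x : M → J → ℝ | 0 ≤ x i j}) ∩
      (⋂ i, ⋂ j, ⋂ (_ : i ∉ S), {x : M → J → ℝ | x i j = 0}) ∩
      (⋂ i, ⋂ j, ⋂ (_ : (T : ℝ≥0∞) < I.p i j), {x : M → J → ℝ | x i j = 0}) ∩
      (⋂ j, {x : M → J → ℝ | ∑ i, x i j ≤ 1}) ∩
      (⋂ i, {x : M → J → ℝ | ∑ j, (I.p i j).toReal * x i j ≤ T}) := by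
    ext x
    simp only [Set.mem_inter_iff, Set.mem_iInter, Set.mem_ofPred_eq]
    exact ⟨fun h => ⟨⟨⟨⟨h.1, h.2⟩, h.3⟩, h.4⟩, h.5⟩,
      fun h => ⟨h.1.1.1.1, h.1.1.1.2, h.1.1.2, h.1.2, h.2⟩⟩
  have hclosed : IsClosed {x | Feasible I T S x} := by
    rw [hset]
    refine (((IsClosed.inter ?_ ?_).inter ?_).inter ?_).inter ?_
    · exact isClosed_iInter fun i => isClosed_iInter fun j =>
        isClosed_le (by fun_prop) (by fun_prop)
    · exact isClosed_iInter fun i => isClosed_iInter fun j => isClosed_iInter fun _ =>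
        isClosed_eq (by fun_prop) (by fun_prop)
    · exact isClosed_iInter fun i => isClosed_iInter fun j => isClosed_iInter fun _ =>
        isClosed_eq (by fun_prop) (by fun_prop)
    · exact isClosed_iInter fun j => isClosed_le (by fun_prop) (by fun_prop)
    · exact isClosed_iInter fun i => isClosed_le (by fun_prop) (by fun_prop)
  have hcompact : IsCompact {x | Feasible I T S x} :=
    (isCompact_Icc (a := (0 : M → J → ℝ)) (b := fun _ _ => 1)).of_isClosed_subset hclosed
      fun x hx => ⟨fun i j => hx.nonneg i j, fun i j => hle x hx i j⟩
  have hne : {x | Feasible I T S x}.Nonempty :=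
    ⟨0, by constructor <;> simp⟩
  obtain ⟨x, hx, hmax⟩ := hcompact.exists_isMaxOn hne
    (f := amount) (by unfold amount; fun_prop)
  exact ⟨x, hx, fun y hy => hmax hy⟩

/-- The optimal value of `LP(S)` is attained. -/
theorem lpValue_eq (I : Problem M J) (T : ℝ≥0) (S : Finset M) (x : M → J → ℝ)
    (hx : IsOptimal I T S x) : lpValue I T S = amount x :=
  IsGreatest.csSup_eq ⟨⟨x, hx.1, rfl⟩, by rintro _ ⟨y, hy, rfl⟩; exact hx.2 y hy⟩

/-! ### The greedy algorithm -/

variable [DecidableEq M]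

/-- The gain-to-cost ratio of activating machine `i` in addition to `S`.  In `ℝ≥0∞` a positive gain
at cost `0` has ratio `∞`, and no gain at cost `0` has ratio `0`. -/
noncomputable def ratio (I : Problem M J) (T : ℝ≥0) (S : Finset M) (i : M) : ℝ≥0∞ :=
  ENNReal.ofReal (lpValue I T (insert i S) - lpValue I T S) / (I.a i : ℝ≥0∞)

/-- Stopping rule: more than `n - 1` of the `n` jobs can be processed fractionally by `S`. -/
def Done (I : Problem M J) (T : ℝ≥0) (S : Finset M) : Prop :=
  (Fintype.card J : ℝ) - 1 < lpValue I T S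

/-- `i` is a possible greedy choice at `S`: an inactive machine of maximum ratio, with some gain. -/
def IsGreedyChoice (I : Problem M J) (T : ℝ≥0) (S : Finset M) (i : M) : Prop :=
  i ∉ S ∧ 0 < ratio I T S i ∧ ∀ k, k ∉ S → ratio I T S k ≤ ratio I T S i

/-- `Reaches I T S k c`: the greedy algorithm, with ties broken in some way, has activated the set
`S` after `k` steps, and has solved `c` linear programs.  It starts from `∅` (with `LP(∅) = 0`
known).  As long as it is not done, a step solves `LP(S ∪ {i})` for every inactive machine `i`, and
activates a machine of maximum ratio. -/
inductive Reaches (I : Problem M J) (T : ℝ≥0) : Finset M → ℕ → ℕ → Prop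
  | start : Reaches I T ∅ 0 0
  | step {S : Finset M} {k c : ℕ} {i : M} (h : Reaches I T S k c) (hS : ¬ Done I T S)
      (hi : IsGreedyChoice I T S i) : Reaches I T (insert i S) (k + 1) (c + Sᶜ.card)

/-! ### Rounding a fractional assignment

Each machine `i` lists its jobs by non-increasing processing time, and the pieces `x i j` are laid
out in this order on the half-line, which is cut into the unit slots `[s, s + 1]`, `s = 0, 1, …`.
Job `j` is joined to the slots that its piece overlaps, and the jobs are then matched to slots. -/

/-- `ord i` is an order of the jobs by non-increasing processing time on machine `i`. -/
def IsSortedOrder (I : Problem M J) (ord : M → J ≃ Fin (Fintype.card J)) : Prop :=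
  ∀ i j j', ord i j ≤ ord i j' → I.p i j' ≤ I.p i j

/-- Where the piece of job `j` begins on the line of machine `i`. -/
noncomputable def offset (ord : M → J ≃ Fin (Fintype.card J)) (x : M → J → ℝ) (i : M) (j : J) :
    ℝ :=
  ∑ j' with ord i j' < ord i j, x i j'

/-- The piece of job `j` on machine `i` overlaps slot `s` in an interval of positive length. -/
def InSlot (ord : M → J ≃ Fin (Fintype.card J)) (x : M → J → ℝ) (i : M) (j : J) (s : ℕ) : Prop :=
  max (offset ord x i j) s < min (offset ord x i j + x i j) (s + 1)

/-- `σ` is obtained from the fractional assignment `x` (laid out by `ord`) by matching every job to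
a slot of its own among the slots that it overlaps, and sending it to the machine of that slot.
(A piece never lies beyond the first `n` slots, since `x i j ≤ 1`.) -/
def IsRounding (ord : M → J ≃ Fin (Fintype.card J)) (x : M → J → ℝ) (σ : J → M) : Prop :=
  ∃ slot : J → Fin (Fintype.card J), (∀ j, InSlot ord x (σ j) j (slot j)) ∧
    Function.Injective fun j => (σ j, slot j)

/-- `Outputs I T s k c`: the algorithm, with ties broken in some way, stops after `k` greedy steps
and `c` linear programs with the schedule `s`, a rounding of an optimal solution of `LP(S)` for the
final set `S`. -/
def Outputs (I : Problem M J) (T : ℝ≥0) (s : Schedule M J) (k c : ℕ) : Prop :=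
  Reaches I T s.active k c ∧ Done I T s.active ∧
    ∃ x, IsOptimal I T s.active x ∧ ∃ ord, IsSortedOrder I ord ∧ IsRounding ord x s.assign

end MachineActivation

/-!
The optimal value `f(S)` of `LP(S)` is a monotone submodular function of the set `S` of machines
(`lpValue_union_add_inter_le`).  By linear programming duality (`exists_dualFeasible`, obtained from
the separation of a compact convex set from an orthant), `f(S)` is the infimum of
`∑ j, u j + T ∑ i ∈ S, v i` over prices with `u j + p i j * v i ≥ 1` for the admissible pairs with
`i ∈ S`.  Taking the maximum of the job prices and the minimum of the machine prices of dual
solutions for `X` and `Y` gives one for `X ∪ Y`; the opposite choice gives one for `X ∩ Y`; and the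
total value is unchanged.

Submodularity has two uses.
* Let `w = n - f(S)` be what is lacking.  The machines of a schedule that meets the deadline have
  gains of total at least `w` and costs of total at most `A`, so some machine can be chosen while
  `w ≥ 1` (`exists_isGreedyChoice`), and a greedy choice with gain `w - w'` costs at most `A (w - w') / w`
  (`IsGreedyChoice.cost_mul_le`).  This is at most `A (ln w - ln w')` in general, and at most `A` in
  the last step; the sum telescopes to at most `A (1 + ln n)` (`Reaches.cost_le`).
* The selected machines can be matched to distinct jobs that they can process within time `T`
  (`Reaches.hall`).  If a new machine violated Hall's condition, some of the old machines could
  already process all the jobs that are within reach of themselves and the new one, which would then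
  have no gain.  So there are at most `n` greedy steps.

For the rounding, the length of a piece within a slot is a difference of values of the
projection `clamp s` to the slot, so that all sums of such lengths telescope.  If more than `n - 1`
jobs are processed, the slots of any set `D` of jobs have total length more than `|D| - 1`, and
Hall's theorem gives the matching (`Feasible.exists_isRounding`).  On each machine, a job in slot `s + 1` is
no longer than the average job in slot `s`, so all jobs outside the first slot together take at most
`T`, as does the job in the first slot (`Feasible.makespan_le`).
-/

namespace MachineActivation

/-! ### Duality for the linear program -/

/-- A compact convex set that contains no point above `c` is separated from `c` by a nonnegative
weighting of the coordinates. -/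
theorem exists_nonneg_weights_lt {κ : Type*} [Fintype κ] {K : Set (κ → ℝ)} (hK : IsCompact K)
    (hconv : Convex ℝ K) (c : κ → ℝ) (h : ∀ z ∈ K, ¬ c ≤ z) :
    ∃ w : κ → ℝ, (∀ k, 0 ≤ w k) ∧ ∀ z ∈ K, ∑ k, w k * z k < ∑ k, w k * c k := by
  classical
  obtain ⟨f, s, t, hs, hst, ht⟩ := geometric_hahn_banach_compact_closed hconv hK (convex_Ici c)
    isClosed_Ici (Set.disjoint_left.2 h)
  have hf : ∀ z : κ → ℝ, f z = ∑ k, f (Pi.single k 1) * z k := fun z => by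
    have := LinearMap.pi_apply_eq_sum_univ f.toLinearMap z
    simp only [ContinuousLinearMap.coe_coe, smul_eq_mul] at this
    rw [this]
    refine Finset.sum_congr rfl fun k _ => ?_
    rw [mul_comm]
    congr 2
    ext l
    simp [Pi.single_apply, eq_comm]
  have hc : t < f c := ht c (Set.mem_Ici.2 le_rfl)
  refine ⟨fun k => f (Pi.single k 1), fun k => ?_, fun z hz => ?_⟩
  · by_contra! hneg
    -- moving far enough in direction `k` would bring `f` down to `t`
    have hm : 0 ≤ (f c - t) / -f (Pi.single k 1) := div_nonneg (by linarith) (by linarith)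
    have := ht (c + ((f c - t) / -f (Pi.single k 1)) • Pi.single k (1 : ℝ)) (by
      rw [Set.mem_Ici]
      refine le_add_of_nonneg_right (smul_nonneg hm ?_)
      exact Pi.single_nonneg.2 zero_le_one)
    rw [map_add, map_smul, smul_eq_mul, div_mul_eq_mul_div, mul_div_assoc, div_neg,
      div_self hneg.ne] at this
    linarith
  · rw [← hf, ← hf]
    exact (hs z hz).trans (hst.trans hc)

variable {M J : Type*} [Fintype M] [Fintype J]

theorem Feasible.le_one {I : Problem M J} {T : ℝ≥0} {S : Finset M} {x : M → J → ℝ}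
    (hx : Feasible I T S x) (i : M) (j : J) : x i j ≤ 1 :=
  (Finset.single_le_sum (f := fun i => x i j) (fun i _ => hx.nonneg i j)
    (Finset.mem_univ i)).trans (hx.job j)

theorem Feasible.mono {I : Problem M J} {T : ℝ≥0} {S R : Finset M} {x : M → J → ℝ}
    (hx : Feasible I T S x) (h : S ⊆ R) : Feasible I T R x :=
  ⟨hx.nonneg, fun i j hi => hx.inactive i j fun hS => hi (h hS), hx.too_long, hx.job, hx.machine⟩

theorem Feasible.amount_le_lpValue {I : Problem M J} {T : ℝ≥0} {S : Finset M} {x : M → J → ℝ}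
    (hx : Feasible I T S x) : amount x ≤ lpValue I T S := by
  obtain ⟨y, hy⟩ := exists_isOptimal I T S
  rw [lpValue_eq I T S y hy]
  exact hy.2 x hx

theorem lpValue_le {I : Problem M J} {T : ℝ≥0} {S : Finset M} {b : ℝ}
    (h : ∀ x, Feasible I T S x → amount x ≤ b) : lpValue I T S ≤ b := by
  obtain ⟨y, hy⟩ := exists_isOptimal I T S
  rw [lpValue_eq I T S y hy]
  exact h y hy.1

theorem lpValue_mono (I : Problem M J) (T : ℝ≥0) {S R : Finset M} (h : S ⊆ R) :
    lpValue I T S ≤ lpValue I T R :=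
  lpValue_le fun _ hx => (hx.mono h).amount_le_lpValue

theorem lpValue_nonneg (I : Problem M J) (T : ℝ≥0) (S : Finset M) : 0 ≤ lpValue I T S := by
  have h : Feasible I T S 0 := by constructor <;> simp
  simpa [amount] using h.amount_le_lpValue

theorem lpValue_le_card (I : Problem M J) (T : ℝ≥0) (S : Finset M) :
    lpValue I T S ≤ Fintype.card J :=
  lpValue_le fun x hx => by
    rw [amount, Finset.sum_comm]
    exact (Finset.sum_le_sum fun j _ => hx.job j).trans (by simp)

/-- The feasible region of the dual of `LP(S)`: prices `u j` of the jobs and `v i` of a time unit on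
machine `i`, such that no admissible pair of a job and a machine of `S` is worth more than it costs.
The prices of machines outside `S` are irrelevant. -/
structure DualFeasible (I : Problem M J) (T : ℝ≥0) (S : Finset M) (u : J → ℝ) (v : M → ℝ) :
    Prop where
  job_nonneg : ∀ j, 0 ≤ u j
  machine_nonneg : ∀ i, 0 ≤ v i
  cover : ∀ i ∈ S, ∀ j, I.p i j ≤ T → 1 ≤ u j + (I.p i j).toReal * v i

/-- The objective of the dual of `LP(S)`. -/
noncomputable def dualValue (T : ℝ≥0) (S : Finset M) (u : J → ℝ) (v : M → ℝ) : ℝ :=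
  ∑ j, u j + T * ∑ i ∈ S, v i

/-- Weak duality. -/
theorem DualFeasible.lpValue_le_dualValue {I : Problem M J} {T : ℝ≥0} {S : Finset M} {u : J → ℝ}
    {v : M → ℝ} (h : DualFeasible I T S u v) : lpValue I T S ≤ dualValue T S u v := by
  classical
  refine lpValue_le fun x hx => ?_
  have h1 : ∀ i j, x i j ≤ u j * x i j + if i ∈ S then v i * ((I.p i j).toReal * x i j) else 0 := by
    intro i j
    by_cases hi : i ∈ S
    · by_cases hp : I.p i j ≤ T
      · have := mul_le_mul_of_nonneg_right (h.cover i hi j hp) (hx.nonneg i j)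
        rw [if_pos hi]
        linarith
      · simp [hx.too_long i j (not_le.1 hp)]
    · simp [hx.inactive i j hi]
  calc amount x ≤ ∑ i, ∑ j, (u j * x i j + if i ∈ S then v i * ((I.p i j).toReal * x i j) else 0) :=
        Finset.sum_le_sum fun i _ => Finset.sum_le_sum fun j _ => h1 i j
    _ = ∑ j, u j * ∑ i, x i j + ∑ i ∈ S, v i * ∑ j, (I.p i j).toReal * x i j := by
        simp only [Finset.sum_add_distrib, Finset.mul_sum]
        rw [Finset.sum_comm]
        congr 1
        rw [← Finset.sum_subset (Finset.subset_univ S) fun i _ hi => by simp [hi]]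
        exact Finset.sum_congr rfl fun i hi => by simp [hi]
    _ ≤ ∑ j, u j * 1 + ∑ i ∈ S, v i * T := by
        refine add_le_add (Finset.sum_le_sum fun j _ => ?_) (Finset.sum_le_sum fun i _ => ?_)
        · exact mul_le_mul_of_nonneg_left (hx.job j) (h.job_nonneg j)
        · exact mul_le_mul_of_nonneg_left (hx.machine i) (h.machine_nonneg i)
    _ = dualValue T S u v := by simp [dualValue, ← Finset.sum_mul, mul_comm]

/-- The left-hand sides of `LP(S)` as one linear map: the objective, and the negated constraints of
the jobs and of the machines. -/
def lpMap (I : Problem M J) : (M → J → ℝ) →ₗ[ℝ] (Unit ⊕ J ⊕ M → ℝ) where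
  toFun x := Sum.elim (fun _ => ∑ i, ∑ j, x i j)
    (Sum.elim (fun j => -∑ i, x i j) fun i => -∑ j, (I.p i j).toReal * x i j)
  map_add' x y := by
    ext k
    rcases k with _ | j | i <;> simp [Finset.sum_add_distrib, mul_add] <;> ring
  map_smul' c x := by
    ext k
    rcases k with _ | j | i <;> simp [Finset.mul_sum, mul_left_comm]

/-- Strong duality, in the approximate form that needs no attainment of the dual optimum. -/
theorem exists_dualFeasible (I : Problem M J) (T : ℝ≥0) (S : Finset M) {ε : ℝ} (hε : 0 < ε) :
    ∃ u v, DualFeasible I T S u v ∧ dualValue T S u v ≤ lpValue I T S + ε := by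
  classical
  set L := lpValue I T S + ε with hL
  have hLpos : 0 < L := by linarith [lpValue_nonneg I T S]
  set B : Set (M → J → ℝ) := Set.Icc 0 (fun i j => if i ∈ S ∧ I.p i j ≤ T then 1 else 0) with hB
  have hcompact : IsCompact (lpMap I '' B) :=
    isCompact_Icc.image (LinearMap.continuous_of_finiteDimensional _)
  obtain ⟨w, hw, hlt⟩ := exists_nonneg_weights_lt hcompact ((convex_Icc _ _).linear_image _)
    (Sum.elim (fun _ => L) (Sum.elim (fun _ => -1) fun _ => -T)) (by
      rintro _ ⟨x, hx, rfl⟩ hle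
      have hfeas : Feasible I T S x := by
        refine ⟨fun i j => hx.1 i j, fun i j hi => ?_, fun i j hp => ?_, fun j => ?_, fun i => ?_⟩
        · exact le_antisymm (by simpa [hi] using hx.2 i j) (hx.1 i j)
        · exact le_antisymm (by simpa [not_le.2 hp] using hx.2 i j) (hx.1 i j)
        · simpa [lpMap] using hle (.inr (.inl j))
        · simpa [lpMap] using hle (.inr (.inr i))
      have h1 : L ≤ amount x := by simpa [lpMap, amount] using hle (.inl ())
      linarith [hfeas.amount_le_lpValue])
  set w₀ := w (.inl ())
  have hlt' : ∀ x ∈ B, w₀ * ∑ i, ∑ j, x i j - ∑ j, w (.inr (.inl j)) * ∑ i, x i j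
      - ∑ i, w (.inr (.inr i)) * ∑ j, (I.p i j).toReal * x i j
      < w₀ * L - ∑ j, w (.inr (.inl j)) - ∑ i, w (.inr (.inr i)) * T := fun x hx => by
    have := hlt _ ⟨x, hx, rfl⟩
    simp only [lpMap, LinearMap.coe_mk, AddHom.coe_mk, Fintype.sum_sum_type, Sum.elim_inl,
      Sum.elim_inr, Finset.univ_unique, Finset.sum_singleton, mul_neg, Finset.sum_neg_distrib,
      mul_one] at this
    simp only [w₀]
    have hd : (default : Unit) = () := rfl
    rw [hd] at this
    linarith
  -- the point `x = 0` satisfies the constraints, so the objective has a positive weight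
  have hw₀ : 0 < w₀ := by
    refine (hw _).lt_of_ne fun h0 => ?_
    have := hlt' 0 ⟨le_rfl, fun i j => by dsimp; split_ifs <;> simp⟩
    rw [show w₀ = 0 from h0.symm] at this
    simp only [Pi.zero_apply, mul_zero, Finset.sum_const_zero, zero_mul, sub_zero] at this
    have h1 : 0 ≤ ∑ j, w (.inr (.inl j)) := Finset.sum_nonneg fun j _ => hw _
    have h2 : 0 ≤ ∑ i, w (.inr (.inr i)) * (T : ℝ) :=
      Finset.sum_nonneg fun i _ => mul_nonneg (hw _) T.2
    linarith
  set u : J → ℝ := fun j => w (.inr (.inl j)) / w₀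
  set v : M → ℝ := fun i => w (.inr (.inr i)) / w₀
  have hu : ∀ j, 0 ≤ u j := fun j => div_nonneg (hw _) hw₀.le
  have hv : ∀ i, 0 ≤ v i := fun i => div_nonneg (hw _) hw₀.le
  have hwu : ∀ j, w (.inr (.inl j)) = w₀ * u j := fun j => by
    simp only [u]; field_simp
  have hwv : ∀ i, w (.inr (.inr i)) = w₀ * v i := fun i => by
    simp only [v]; field_simp
  have key : ∀ x ∈ B, ∑ i, ∑ j, (1 - u j - (I.p i j).toReal * v i) * x i j
      + (∑ j, u j + T * ∑ i, v i) < L := fun x hx => by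
    have h := hlt' x hx
    simp only [hwu, hwv] at h
    have e : ∑ i, ∑ j, (1 - u j - (I.p i j).toReal * v i) * x i j = ∑ i, ∑ j, x i j
        - ∑ j, u j * ∑ i, x i j - ∑ i, v i * ∑ j, (I.p i j).toReal * x i j := by
      simp only [Finset.mul_sum]
      rw [Finset.sum_comm (s := (Finset.univ : Finset J)), ← Finset.sum_sub_distrib,
        ← Finset.sum_sub_distrib]
      refine Finset.sum_congr rfl fun i _ => ?_
      rw [← Finset.sum_sub_distrib, ← Finset.sum_sub_distrib]
      exact Finset.sum_congr rfl fun j _ => by ring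
    rw [e]
    simp only [mul_assoc, ← Finset.mul_sum, ← mul_sub] at h
    have h' := lt_of_mul_lt_mul_left h hw₀.le
    rw [← Finset.sum_mul] at h'
    linarith
  -- the prices `u`, `v` may violate some constraints; the total violation is added to `u`
  set r : M → J → ℝ := fun i j =>
    if i ∈ S ∧ I.p i j ≤ T then max 0 (1 - u j - (I.p i j).toReal * v i) else 0 with hr
  have hr0 : ∀ i j, 0 ≤ r i j := fun i j => by
    simp only [hr]; split_ifs <;> simp
  refine ⟨fun j => u j + ∑ i, r i j, v, ⟨fun j => ?_, hv, fun i hi j hp => ?_⟩, ?_⟩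
  · exact add_nonneg (hu j) (Finset.sum_nonneg fun i _ => hr0 i j)
  · have h1 : r i j ≤ ∑ i, r i j :=
      Finset.single_le_sum (f := fun i => r i j) (fun i _ => hr0 i j) (Finset.mem_univ i)
    have h2 : 1 - u j - (I.p i j).toReal * v i ≤ r i j := by
      simp only [hr, if_pos (And.intro hi hp)]
      exact le_max_right _ _
    linarith
  · have h := key (fun i j => if (i ∈ S ∧ I.p i j ≤ T) ∧ 0 < 1 - u j - (I.p i j).toReal * v i
      then 1 else 0) ⟨fun i j => by dsimp; split_ifs <;> simp, fun i j => by
        dsimp; split_ifs <;> simp_all⟩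
    have e : ∀ i j, (1 - u j - (I.p i j).toReal * v i) *
        (if (i ∈ S ∧ I.p i j ≤ T) ∧ 0 < 1 - u j - (I.p i j).toReal * v i then (1 : ℝ) else 0)
        = r i j := fun i j => by
      simp only [hr]
      by_cases h1 : i ∈ S ∧ I.p i j ≤ T
      · by_cases h2 : 0 < 1 - u j - (I.p i j).toReal * v i
        · rw [if_pos ⟨h1, h2⟩, if_pos h1, max_eq_right h2.le, mul_one]
        · rw [if_neg fun h => h2 h.2, if_pos h1, max_eq_left (not_lt.1 h2), mul_zero]
      · rw [if_neg fun h => h1 h.1, if_neg h1, mul_zero]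
    simp only [e] at h
    have hS : ∑ i ∈ S, v i ≤ ∑ i, v i :=
      Finset.sum_le_sum_of_subset_of_nonneg (Finset.subset_univ S) fun i _ _ => hv i
    have hTS := mul_le_mul_of_nonneg_left hS T.2
    rw [dualValue, Finset.sum_add_distrib, Finset.sum_comm]
    simp only [NNReal.val_eq_coe] at hTS
    linarith

/-! ### Submodularity of the optimal value -/

variable [DecidableEq M]

/-- Dual solutions for `X` and `Y` combine to dual solutions for `X ∪ Y` (larger job prices, smaller
machine prices) and for `X ∩ Y` (the other way round) of the same total value. -/
theorem lpValue_union_add_inter_le (I : Problem M J) (T : ℝ≥0) (X Y : Finset M) :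
    lpValue I T (X ∪ Y) + lpValue I T (X ∩ Y) ≤ lpValue I T X + lpValue I T Y := by
  refine le_of_forall_pos_le_add fun ε hε => ?_
  obtain ⟨u₁, v₁, h₁, hv₁⟩ := exists_dualFeasible I T X (half_pos hε)
  obtain ⟨u₂, v₂, h₂, hv₂⟩ := exists_dualFeasible I T Y (half_pos hε)
  set v : M → ℝ := fun i =>
    if i ∈ X then if i ∈ Y then min (v₁ i) (v₂ i) else v₁ i else v₂ i with hv
  have hunion : DualFeasible I T (X ∪ Y) (fun j => max (u₁ j) (u₂ j)) v := by
    refine ⟨fun j => le_max_of_le_left (h₁.job_nonneg j), fun i => ?_, fun i hi j hp => ?_⟩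
    · have := h₁.machine_nonneg i
      have := h₂.machine_nonneg i
      simp only [hv]
      split_ifs <;> simp [*]
    · have hc₁ : i ∈ X → 1 ≤ max (u₁ j) (u₂ j) + (I.p i j).toReal * v₁ i := fun h =>
        (h₁.cover i h j hp).trans (by gcongr; exact le_max_left _ _)
      have hc₂ : i ∈ Y → 1 ≤ max (u₁ j) (u₂ j) + (I.p i j).toReal * v₂ i := fun h =>
        (h₂.cover i h j hp).trans (by gcongr; exact le_max_right _ _)
      simp only [hv]
      split_ifs with hX hY
      · rcases min_choice (v₁ i) (v₂ i) with h | h <;> rw [h]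
        exacts [hc₁ hX, hc₂ hY]
      · exact hc₁ hX
      · exact hc₂ ((Finset.mem_union.1 hi).resolve_left hX)
  have hinter : DualFeasible I T (X ∩ Y) (fun j => min (u₁ j) (u₂ j))
      fun i => max (v₁ i) (v₂ i) := by
    refine ⟨fun j => le_min (h₁.job_nonneg j) (h₂.job_nonneg j),
      fun i => le_max_of_le_left (h₁.machine_nonneg i), fun i hi j hp => ?_⟩
    rw [Finset.mem_inter] at hi
    rcases min_choice (u₁ j) (u₂ j) with h | h <;> rw [h]
    · exact (h₁.cover i hi.1 j hp).trans (by gcongr; exact le_max_left _ _)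
    · exact (h₂.cover i hi.2 j hp).trans (by gcongr; exact le_max_right _ _)
  have hu : ∑ j, max (u₁ j) (u₂ j) + ∑ j, min (u₁ j) (u₂ j) = ∑ j, u₁ j + ∑ j, u₂ j := by
    rw [← Finset.sum_add_distrib, ← Finset.sum_add_distrib]
    exact Finset.sum_congr rfl fun j _ => max_add_min _ _
  have hm : ∑ i ∈ X ∪ Y, v i + ∑ i ∈ X ∩ Y, max (v₁ i) (v₂ i) = ∑ i ∈ X, v₁ i + ∑ i ∈ Y, v₂ i := by
    have ind : ∀ (R : Finset M) (g : M → ℝ), ∑ i ∈ R, g i = ∑ i, if i ∈ R then g i else 0 := by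
      simp
    rw [ind (X ∪ Y), ind (X ∩ Y), ind X, ind Y, ← Finset.sum_add_distrib, ← Finset.sum_add_distrib]
    refine Finset.sum_congr rfl fun i _ => ?_
    by_cases hX : i ∈ X <;> by_cases hY : i ∈ Y <;> simp [hv, hX, hY, min_add_max]
  have h3 := hunion.lpValue_le_dualValue
  have h4 := hinter.lpValue_le_dualValue
  have h5 : dualValue T (X ∪ Y) (fun j => max (u₁ j) (u₂ j)) v
      + dualValue T (X ∩ Y) (fun j => min (u₁ j) (u₂ j)) (fun i => max (v₁ i) (v₂ i))
      = dualValue T X u₁ v₁ + dualValue T Y u₂ v₂ := by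
    simp only [dualValue]
    linear_combination hu + (T : ℝ) * hm
  linarith

/-- Diminishing returns: a set that contains `S` gains no more from `R` than `S` does. -/
theorem lpValue_union_add_le (I : Problem M J) (T : ℝ≥0) {S X Y : Finset M} (hX : S ⊆ X)
    (hY : S ⊆ Y) : lpValue I T (X ∪ Y) + lpValue I T S ≤ lpValue I T X + lpValue I T Y :=
  (add_le_add_right (lpValue_mono I T (Finset.subset_inter hX hY)) _).trans
    (lpValue_union_add_inter_le I T X Y)

theorem lpValue_union_le_add_sum (I : Problem M J) (T : ℝ≥0) (S R : Finset M) :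
    lpValue I T (S ∪ R) ≤ lpValue I T S + ∑ k ∈ R, (lpValue I T (insert k S) - lpValue I T S) := by
  induction R using Finset.induction_on with
  | empty => simp
  | insert k R hk ih =>
    have h := lpValue_union_add_le I T (X := S ∪ R) (Y := insert k S) Finset.subset_union_left
      (Finset.subset_insert k S)
    rw [show S ∪ R ∪ insert k S = S ∪ insert k R by grind] at h
    rw [Finset.sum_insert hk]
    linarith

end MachineActivation

namespace MachineActivation

variable {M J : Type*} [Fintype M] [Fintype J] [DecidableEq M]

/-! ### Greedy choices -/

theorem lpValue_eq_card_of_schedule {I : Problem M J} {T : ℝ≥0} {s : Schedule M J}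
    (hs : s.makespan I ≤ T) : lpValue I T s.active = Fintype.card J := by
  have hload : ∀ i, s.load I i ≤ T := fun i => (le_iSup (fun i => s.load I i) i).trans hs
  have hp : ∀ j, I.p (s.assign j) j ≤ T := fun j =>
    (Finset.single_le_sum (f := fun j' => I.p (s.assign j) j') (fun _ _ => zero_le)
      (by simp)).trans (hload (s.assign j))
  have hx : Feasible I T s.active fun i j => if s.assign j = i then 1 else 0 := by
    refine ⟨fun i j => by split_ifs <;> simp, fun i j hi => ?_, fun i j hlt => ?_, fun j => by simp,
      fun i => ?_⟩
    · exact if_neg fun h : s.assign j = i => hi (h ▸ s.assign_mem j)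
    · exact if_neg fun h : s.assign j = i => absurd (hp j) (not_le.2 (h ▸ hlt))
    · simp only [mul_ite, mul_one, mul_zero]
      rw [← Finset.sum_filter, ← ENNReal.toReal_sum fun j hj => ?_]
      · exact ENNReal.toReal_mono ENNReal.coe_ne_top (hload i)
      · obtain rfl := (Finset.mem_filter.1 hj).2
        exact ne_top_of_le_ne_top ENNReal.coe_ne_top (hp j)
  refine le_antisymm (lpValue_le_card I T _) ?_
  have h := hx.amount_le_lpValue
  rw [amount, Finset.sum_comm] at h
  simpa using h

/-- By submodularity, the amount of jobs that `S` lacks is at most the sum of the gains of the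
machines of a schedule that meets the deadline. -/
theorem card_sub_lpValue_le_sum {I : Problem M J} {T : ℝ≥0} {s : Schedule M J}
    (hs : s.makespan I ≤ T) (S : Finset M) :
    Fintype.card J - lpValue I T S
      ≤ ∑ k ∈ s.active, (lpValue I T (insert k S) - lpValue I T S) := by
  have h1 := lpValue_union_le_add_sum I T S s.active
  have h2 := lpValue_mono I T (Finset.subset_union_right (s₁ := S) (s₂ := s.active))
  rw [lpValue_eq_card_of_schedule hs] at h2
  linarith

theorem gain_nonneg (I : Problem M J) (T : ℝ≥0) (S : Finset M) (i : M) :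
    0 ≤ lpValue I T (insert i S) - lpValue I T S :=
  sub_nonneg.2 (lpValue_mono I T (Finset.subset_insert i S))

theorem ratio_pos_iff {I : Problem M J} {T : ℝ≥0} {S : Finset M} {i : M} :
    0 < ratio I T S i ↔ lpValue I T S < lpValue I T (insert i S) := by
  rw [ratio, ENNReal.div_pos_iff, ← pos_iff_ne_zero, ENNReal.ofReal_pos, sub_pos]
  simp

theorem exists_isGreedyChoice {I : Problem M J} {T : ℝ≥0} {s : Schedule M J}
    (hs : s.makespan I ≤ T) {S : Finset M} (hS : ¬ Done I T S) : ∃ i, IsGreedyChoice I T S i := by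
  have hpos : (0 : ℝ) < ∑ k ∈ s.active, (lpValue I T (insert k S) - lpValue I T S) := by
    have := card_sub_lpValue_le_sum hs S
    have := not_lt.1 hS
    linarith
  obtain ⟨k, -, hk⟩ := Finset.exists_lt_of_sum_lt (s := s.active) (f := fun _ => (0 : ℝ))
    (g := fun k => lpValue I T (insert k S) - lpValue I T S) (by rwa [Finset.sum_const_zero])
  have hkS : k ∉ S := fun h => by
    rw [Finset.insert_eq_self.2 h, sub_self] at hk
    exact hk.false
  obtain ⟨i, hi, hmax⟩ := Finset.exists_max_image Sᶜ (ratio I T S) ⟨k, by simpa using hkS⟩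
  simp only [Finset.mem_compl] at hi hmax
  exact ⟨i, hi, (ratio_pos_iff.2 (sub_pos.1 hk)).trans_le (hmax k hkS), hmax⟩

/-- A greedy choice is at least as cost-effective as the average over the machines of a schedule
that meets the deadline. -/
theorem IsGreedyChoice.cost_mul_le {I : Problem M J} {T : ℝ≥0} {s : Schedule M J} {A : ℝ}
    (hs : s.makespan I ≤ T) (hA : s.cost I ≤ A) {S : Finset M} {i : M}
    (hi : IsGreedyChoice I T S i) :
    I.a i * (Fintype.card J - lpValue I T S)
      ≤ A * (lpValue I T (insert i S) - lpValue I T S) := by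
  have hA0 : 0 ≤ A := (Finset.sum_nonneg fun i _ => (I.a i).2).trans hA
  have hgi := gain_nonneg I T S i
  rcases eq_or_ne (I.a i) 0 with h0 | h0
  · rw [h0]
    simpa using mul_nonneg hA0 hgi
  have hai : (0 : ℝ) < I.a i := NNReal.coe_pos.2 (pos_iff_ne_zero.2 h0)
  set r : ℝ := (lpValue I T (insert i S) - lpValue I T S) / I.a i with hr
  have hr0 : 0 ≤ r := div_nonneg hgi hai.le
  have hratio : ratio I T S i = ENNReal.ofReal r := by
    rw [ratio, hr, ENNReal.ofReal_div_of_pos hai, ENNReal.ofReal_coe_nnreal]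
  have hk : ∀ k, lpValue I T (insert k S) - lpValue I T S ≤ r * I.a k := fun k => by
    by_cases hkS : k ∈ S
    · rw [Finset.insert_eq_self.2 hkS, sub_self]
      exact mul_nonneg hr0 (I.a k).2
    have h := hi.2.2 k hkS
    rw [hratio, ratio] at h
    -- a machine of cost `0` has no gain here, since the greedy ratio is finite
    have h' := ENNReal.div_le_iff_le_mul (b := (I.a k : ℝ≥0∞)) (c := ENNReal.ofReal r)
      (a := ENNReal.ofReal (lpValue I T (insert k S) - lpValue I T S)) (.inr ENNReal.ofReal_ne_top)
      (.inl ENNReal.coe_ne_top) |>.1 h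
    rw [← ENNReal.ofReal_coe_nnreal, ← ENNReal.ofReal_mul hr0] at h'
    exact (ENNReal.ofReal_le_ofReal_iff (mul_nonneg hr0 (I.a k).2)).1 h'
  have hsum : Fintype.card J - lpValue I T S ≤ r * A :=
    calc _ ≤ ∑ k ∈ s.active, (lpValue I T (insert k S) - lpValue I T S) :=
          card_sub_lpValue_le_sum hs S
      _ ≤ ∑ k ∈ s.active, r * I.a k := Finset.sum_le_sum fun k _ => hk k
      _ = r * s.cost I := by rw [← Finset.mul_sum, Schedule.cost]
      _ ≤ r * A := mul_le_mul_of_nonneg_left hA hr0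
  calc _ ≤ I.a i * (r * A) := mul_le_mul_of_nonneg_left hsum hai.le
    _ = _ := by rw [hr]; field_simp

/-! ### The cost of the greedy set -/

/-- With `w` the amount of jobs still lacking, a step costs at most `A (w - w') / w`.  This is at
most `A (log w - log w')`, which telescopes, and at most `A`, which serves for the last step. -/
theorem Reaches.cost_le {I : Problem M J} {T : ℝ≥0} {s : Schedule M J} {A : ℝ}
    (hs : s.makespan I ≤ T) (hA : s.cost I ≤ A) {S : Finset M} {k c : ℕ} (h : Reaches I T S k c) :
    (¬ Done I T S → ∑ i ∈ S, (I.a i : ℝ)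
      ≤ A * (Real.log (Fintype.card J) - Real.log (Fintype.card J - lpValue I T S))) ∧
    ∑ i ∈ S, (I.a i : ℝ) ≤ A * (1 + Real.log (Fintype.card J)) := by
  have hA0 : 0 ≤ A := (Finset.sum_nonneg fun i _ => (I.a i).2).trans hA
  induction h with
  | start =>
    refine ⟨fun hD => ?_, ?_⟩
    · have := not_lt.1 hD
      have := lpValue_nonneg I T ∅
      rw [Finset.sum_empty]
      exact mul_nonneg hA0 (sub_nonneg.2 (Real.log_le_log (by linarith) (by linarith)))
    · rw [Finset.sum_empty]
      exact mul_nonneg hA0 (add_nonneg zero_le_one (Real.log_natCast_nonneg _))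
  | @step S k c i _ hS hi ih =>
    have ih := ih.1 hS
    have hcost := hi.cost_mul_le hs hA
    rw [Finset.sum_insert hi.1]
    have hw := not_lt.1 hS
    set w := Fintype.card J - lpValue I T S with hwdef
    set w' := Fintype.card J - lpValue I T (insert i S) with hw'def
    have hw1 : 1 ≤ w := by linarith
    have hw'0 : 0 ≤ w' := sub_nonneg.2 (lpValue_le_card I T _)
    have hstep : (I.a i : ℝ) ≤ A * (1 - w' / w) := by
      rw [← mul_le_mul_iff_left₀ (zero_lt_one.trans_le hw1), mul_assoc, sub_mul,
        div_mul_cancel₀ _ (by linarith)]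
      rwa [one_mul, show w - w' = lpValue I T (insert i S) - lpValue I T S by
        rw [hw'def, hwdef]; ring]
    refine ⟨fun hD => ?_, ?_⟩
    · have hD' := not_lt.1 hD
      have hw'1 : 1 ≤ w' := by linarith
      have hlog := Real.log_le_sub_one_of_pos (x := w' / w) (div_pos (by linarith) (by linarith))
      rw [Real.log_div (by linarith) (by linarith)] at hlog
      have := mul_le_mul_of_nonneg_left hlog hA0
      linarith
    · have h1 : 0 ≤ A * (w' / w) := mul_nonneg hA0 (div_nonneg hw'0 (by linarith))
      have h2 : 0 ≤ A * Real.log w := mul_nonneg hA0 (Real.log_nonneg hw1)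
      linarith

end MachineActivation

/-! ### The number of greedy steps -/

namespace MachineActivation

variable {M J : Type*} [Fintype J]

/-- The jobs that can be processed within time `T` on machine `i`. -/
noncomputable def admissible (I : Problem M J) (T : ℝ≥0) (i : M) : Finset J := by
  classical exact {j | I.p i j ≤ T}

@[simp]
theorem mem_admissible {I : Problem M J} {T : ℝ≥0} {i : M} {j : J} :
    j ∈ admissible I T i ↔ I.p i j ≤ T := by
  simp [admissible]

variable [Fintype M] [DecidableEq M]

theorem lpValue_le_card_biUnion [DecidableEq J] (I : Problem M J) (T : ℝ≥0) (S : Finset M) :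
    lpValue I T S ≤ (S.biUnion (admissible I T)).card := by
  refine lpValue_le fun x hx => ?_
  rw [amount, Finset.sum_comm, ← Finset.sum_subset (Finset.subset_univ (S.biUnion (admissible I T)))]
  · simpa using Finset.sum_le_sum fun j (_ : j ∈ S.biUnion (admissible I T)) => hx.job j
  · intro j _ hj
    refine Finset.sum_eq_zero fun i _ => ?_
    by_cases hi : i ∈ S
    · exact hx.too_long i j (not_le.1 fun hp =>
        hj (Finset.mem_biUnion.2 ⟨i, hi, mem_admissible.2 hp⟩))
    · exact hx.inactive i j hi

/-- Machines with distinct admissible jobs can process these jobs. -/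
theorem card_le_lpValue_of_matching {I : Problem M J} {T : ℝ≥0} {S : Finset M} (f : ↥S → J)
    (hf : Function.Injective f) (hp : ∀ i : ↥S, I.p i (f i) ≤ T) : (S.card : ℝ) ≤ lpValue I T S := by
  classical
  have hx : Feasible I T S fun i j => if h : i ∈ S then if f ⟨i, h⟩ = j then 1 else 0 else 0 := by
    refine ⟨fun i j => by split_ifs <;> simp, fun i j hi => dif_neg hi, fun i j hlt => ?_,
      fun j => ?_, fun i => ?_⟩
    · split_ifs with h hj
      · exact absurd (hp ⟨i, h⟩) (not_le.2 (hj ▸ hlt))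
      · rfl
      · rfl
    · rw [← Finset.sum_subset (Finset.subset_univ S) fun i _ hi => dif_neg hi,
        ← Finset.sum_attach]
      simp only [Finset.coe_mem, dite_true, Subtype.coe_eta]
      rw [Finset.sum_boole]
      exact_mod_cast Finset.card_le_one.2 fun i hi i' hi' => by
        rw [Finset.mem_filter] at hi hi'
        exact hf (hi.2.trans hi'.2.symm)
    · by_cases h : i ∈ S
      · simp only [h, dite_true, mul_ite, mul_one, mul_zero, Finset.sum_ite_eq, Finset.mem_univ,
          if_true]
        exact ENNReal.toReal_mono ENNReal.coe_ne_top (hp ⟨i, h⟩)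
      · simp [h]
  refine le_trans (le_of_eq ?_) hx.amount_le_lpValue
  rw [amount, ← Finset.sum_subset (Finset.subset_univ S) fun i _ hi => by simp [hi],
    ← Finset.sum_attach]
  simp

/-- Hall's condition for the machines of `S` and their admissible jobs survives the activation of a
machine `i` with a positive gain.  Otherwise some `R ⊆ S` would have enough machines for all the
jobs that are admissible on `R ∪ {i}`, so that `i` would yield no gain to `R`, hence none to `S`. -/
theorem hall_insert [DecidableEq J] {I : Problem M J} {T : ℝ≥0} {S : Finset M} {i : M}
    (hS : ∀ R ⊆ S, R.card ≤ (R.biUnion (admissible I T)).card)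
    (hgain : lpValue I T S < lpValue I T (insert i S)) :
    ∀ R ⊆ insert i S, R.card ≤ (R.biUnion (admissible I T)).card := by
  intro R hR
  by_contra! hlt
  set Q := R.erase i
  have hQS : Q ⊆ S := by grind
  have hiR : i ∈ R := by
    by_contra hiR
    exact absurd (hS R fun k hk => by grind) (not_le.2 hlt)
  have hins : insert i Q = R := Finset.insert_erase hiR
  have hcard : R.card = Q.card + 1 := by rw [← hins, Finset.card_insert_of_notMem (by simp [Q])]
  obtain ⟨f, hf, hft⟩ := (Finset.all_card_le_biUnion_card_iff_exists_injective
    (fun k : ↥Q => admissible I T k.1)).1 fun D => by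
      have h := hS (D.map (Function.Embedding.subtype _)) fun k hk => by
        obtain ⟨k', -, rfl⟩ := Finset.mem_map.1 hk
        exact hQS k'.2
      rwa [Finset.card_map, Finset.map_eq_image, Finset.image_biUnion] at h
  have h1 : (Q.card : ℝ) ≤ lpValue I T Q :=
    card_le_lpValue_of_matching f hf fun k => mem_admissible.1 (hft k)
  have h2 := lpValue_le_card_biUnion I T R
  have h3 : ((R.biUnion (admissible I T)).card : ℝ) ≤ Q.card := by
    exact_mod_cast (by omega : (R.biUnion (admissible I T)).card ≤ Q.card)
  have h4 := lpValue_union_add_le I T hQS (Finset.subset_insert i Q)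
  rw [Finset.union_insert, Finset.union_eq_left.2 hQS, hins] at h4
  linarith

theorem Reaches.card_eq {I : Problem M J} {T : ℝ≥0} {S : Finset M} {k c : ℕ}
    (h : Reaches I T S k c) : S.card = k := by
  induction h with
  | start => rfl
  | step _ _ hi ih => rw [Finset.card_insert_of_notMem hi.1, ih]

theorem Reaches.hall [DecidableEq J] {I : Problem M J} {T : ℝ≥0} {S : Finset M} {k c : ℕ}
    (h : Reaches I T S k c) : ∀ R ⊆ S, R.card ≤ (R.biUnion (admissible I T)).card := by
  induction h with
  | start => simp
  | step _ _ hi ih => exact hall_insert ih (ratio_pos_iff.1 hi.2.1)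

theorem Reaches.steps_le {I : Problem M J} {T : ℝ≥0} {S : Finset M} {k c : ℕ}
    (h : Reaches I T S k c) : k ≤ min (Fintype.card M) (Fintype.card J) := by
  classical
  rw [← h.card_eq]
  exact le_min (Finset.card_le_univ S) ((h.hall S subset_rfl).trans (Finset.card_le_univ _))

theorem Reaches.lpCount_eq {I : Problem M J} {T : ℝ≥0} {S : Finset M} {k c : ℕ}
    (h : Reaches I T S k c) : c = ∑ i ∈ Finset.Icc 1 k, (Fintype.card M - (i - 1)) := by
  induction h with
  | start => simp
  | step h _ _ ih =>
    rw [Finset.sum_Icc_succ_top (by omega), ← ih, Finset.card_compl, h.card_eq,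
      Nat.add_sub_cancel]

theorem exists_reaches_done {I : Problem M J} {T : ℝ≥0} {s : Schedule M J}
    (hs : s.makespan I ≤ T) : ∃ S k c, Reaches I T S k c ∧ Done I T S := by
  by_contra! hnot
  have hall : ∀ k, ∃ S c, Reaches I T S k c := fun k => by
    induction k with
    | zero => exact ⟨∅, 0, .start⟩
    | succ k ih =>
      obtain ⟨S, c, h⟩ := ih
      obtain ⟨i, hi⟩ := exists_isGreedyChoice hs (hnot S k c h)
      exact ⟨_, _, h.step (hnot S k c h) hi⟩
  obtain ⟨S, c, h⟩ := hall (Fintype.card M + 1)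
  have := h.steps_le.trans (min_le_left _ _)
  omega

end MachineActivation

namespace MachineActivation

variable {M J : Type*} [Fintype J]

/-! ### Pieces laid out on a line of unit slots -/

/-- The point of the slot `[s, s + 1]` that is nearest to `t`. -/
noncomputable def clamp (s : ℕ) (t : ℝ) : ℝ := max s (min t (s + 1))

theorem clamp_mono (s : ℕ) : Monotone (clamp s) := fun _ _ h =>
  max_le_max le_rfl (min_le_min h le_rfl)

theorem le_clamp (s : ℕ) (t : ℝ) : (s : ℝ) ≤ clamp s t := le_max_left _ _

theorem clamp_le (s : ℕ) (t : ℝ) : clamp s t ≤ s + 1 := max_le (by simp) (min_le_right _ _)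

theorem sum_clamp_sub {t : ℝ} (ht : 0 ≤ t) (n : ℕ) :
    ∑ s ∈ Finset.range n, (clamp s t - s) = min t n := by
  induction n with
  | zero => simp [ht]
  | succ n ih =>
    rw [Finset.sum_range_succ, ih]
    push_cast
    simp only [clamp]
    rcases le_total t n with h | h <;> rcases le_total t (n + 1) with h' | h' <;>
      simp [*] <;> linarith

/-- The length of the part of job `j`'s piece on machine `i` that lies in slot `s`. -/
noncomputable def overlap (ord : M → J ≃ Fin (Fintype.card J)) (x : M → J → ℝ) (i : M) (j : J)
    (s : ℕ) : ℝ :=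
  clamp s (offset ord x i j + x i j) - clamp s (offset ord x i j)

/-- The total length of the first `k` pieces on machine `i`. -/
noncomputable def prefixLength (ord : M → J ≃ Fin (Fintype.card J)) (x : M → J → ℝ) (i : M)
    (k : ℕ) : ℝ :=
  ∑ j with (ord i j : ℕ) < k, x i j

theorem prefixLength_val (ord : M → J ≃ Fin (Fintype.card J)) (x : M → J → ℝ) (i : M) (j : J) :
    prefixLength ord x i (ord i j) = offset ord x i j := rfl

theorem filter_lt_succ (e : J ≃ Fin (Fintype.card J)) [DecidableEq J] (j : J) :
    (Finset.univ.filter fun j' => (e j' : ℕ) < e j + 1)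
      = insert j (Finset.univ.filter fun j' => (e j' : ℕ) < e j) := by
  ext j'
  simp only [Finset.mem_filter, Finset.mem_univ, true_and, Finset.mem_insert]
  rw [Nat.lt_succ_iff, le_iff_eq_or_lt, ← Fin.ext_iff, e.injective.eq_iff]

theorem prefixLength_val_succ (ord : M → J ≃ Fin (Fintype.card J)) (x : M → J → ℝ) (i : M) (j : J) :
    prefixLength ord x i (ord i j + 1) = offset ord x i j + x i j := by
  classical
  rw [prefixLength, filter_lt_succ, Finset.sum_insert (by simp), add_comm,
    ← prefixLength_val, prefixLength]

/-- As the pieces follow each other, the increments of a function along the first `k` of them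
telescope. -/
theorem sum_increments (ord : M → J ≃ Fin (Fintype.card J)) (x : M → J → ℝ) (i : M) (g : ℝ → ℝ)
    (k : ℕ) (hk : k ≤ Fintype.card J) :
    ∑ j with (ord i j : ℕ) < k, (g (offset ord x i j + x i j) - g (offset ord x i j))
      = g (prefixLength ord x i k) - g 0 := by
  classical
  induction k with
  | zero => simp [prefixLength]
  | succ k ih =>
    obtain ⟨j, hj⟩ := (ord i).surjective ⟨k, hk⟩
    have hj' : k = ord i j := by simp [hj]
    have := ih (by omega)
    subst hj'
    rw [filter_lt_succ, Finset.sum_insert (by simp), this, prefixLength_val_succ, prefixLength_val]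
    ring

section

variable {ord : M → J ≃ Fin (Fintype.card J)} {x : M → J → ℝ}

theorem overlap_nonneg (hx : ∀ i j, 0 ≤ x i j) (i : M) (j : J) (s : ℕ) :
    0 ≤ overlap ord x i j s :=
  sub_nonneg.2 (clamp_mono s (by linarith [hx i j]))

theorem inSlot_of_overlap_pos {i : M} {j : J} {s : ℕ} (h : 0 < overlap ord x i j s) :
    InSlot ord x i j s := by
  rw [overlap, sub_pos] at h
  rw [InSlot, max_lt_iff, lt_min_iff, lt_min_iff]
  refine ⟨⟨(clamp_mono s).reflect_lt h, ?_⟩, ?_, by simp⟩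
  · by_contra! hc
    refine absurd h (not_lt.2 ((clamp_le s _).trans ?_))
    rw [clamp, min_eq_right hc]
    exact le_max_right _ _
  · by_contra! hc
    refine absurd h (not_lt.2 (le_trans ?_ (le_clamp s _)))
    exact max_le le_rfl ((min_le_left _ _).trans hc)

theorem InSlot.pos {i : M} {j : J} {s : ℕ} (h : InSlot ord x i j s) : 0 < x i j := by
  rw [InSlot, max_lt_iff, lt_min_iff] at h
  linarith [h.1.1]

theorem sum_overlap_jobs_le_one (i : M) (s : ℕ) : ∑ j, overlap ord x i j s ≤ 1 := by
  have h := sum_increments ord x i (clamp s) _ le_rfl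
  rw [Finset.filter_true_of_mem fun j _ => (ord i j).2] at h
  refine (show ∑ j, overlap ord x i j s = _ from h).le.trans ?_
  linarith [clamp_le s (prefixLength ord x i (Fintype.card J)), le_clamp s 0]

/-- Every piece lies in the first `n` slots. -/
theorem sum_overlap_slots (hx : ∀ i j, 0 ≤ x i j) (hx1 : ∀ i j, x i j ≤ 1) (i : M) (j : J) :
    ∑ s : Fin (Fintype.card J), overlap ord x i j s = x i j := by
  have h0 : 0 ≤ offset ord x i j := Finset.sum_nonneg fun _ _ => hx _ _
  have h1 : offset ord x i j + x i j ≤ Fintype.card J := by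
    rw [← prefixLength_val_succ, prefixLength]
    calc _ ≤ ∑ j, x i j :=
          Finset.sum_le_sum_of_subset_of_nonneg (Finset.subset_univ _) fun _ _ _ => hx _ _
      _ ≤ ∑ _j : J, (1 : ℝ) := Finset.sum_le_sum fun _ _ => hx1 _ _
      _ = _ := by simp
  rw [Fin.sum_univ_eq_sum_range (fun s => overlap ord x i j s)]
  have e : ∀ s : ℕ, overlap ord x i j s = (clamp s (offset ord x i j + x i j) - s)
      - (clamp s (offset ord x i j) - s) := fun s => by rw [overlap]; ring
  simp only [e]
  rw [Finset.sum_sub_distrib, sum_clamp_sub (by linarith [hx i j]), sum_clamp_sub h0,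
    min_eq_left h1, min_eq_left (by linarith [hx i j])]
  ring

/-- A job in slot `s + 1` is preceded by pieces that fill slot `s` completely. -/
theorem InSlot.sum_overlap_eq_one {i : M} {j : J} {s : ℕ} (h : InSlot ord x i j (s + 1)) :
    ∑ j' with (ord i j' : ℕ) < ord i j + 1, overlap ord x i j' s = 1 := by
  refine (sum_increments ord x i (clamp s) _ (ord i j).2).trans ?_
  rw [InSlot, max_lt_iff, lt_min_iff, lt_min_iff] at h
  have h1 := h.2.1
  push_cast at h1
  rw [prefixLength_val_succ, clamp, clamp, min_eq_right h1.le, max_eq_right (by simp),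
    min_eq_left (by positivity), max_eq_left (by positivity)]
  ring

end

/-! ### Existence of a rounding -/

variable [Fintype M] {I : Problem M J} {T : ℝ≥0} {S : Finset M} {x : M → J → ℝ}

/-- Hall's condition holds for the jobs and their slots: the slots of a set `D` of jobs carry the
pieces of these jobs, of total length more than `|D| - 1`, and each has length `1`. -/
theorem Feasible.exists_isRounding (hx : Feasible I T S x)
    (hn : (Fintype.card J : ℝ) - 1 < amount x) (ord : M → J ≃ Fin (Fintype.card J)) :
    ∃ s : Schedule M J, s.active = S ∧ IsRounding ord x s.assign := by
  classical
  set t : J → Finset (M × Fin (Fintype.card J)) := fun j =>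
    Finset.univ.filter fun is => InSlot ord x is.1 j is.2 with ht
  have hall : ∀ D : Finset J, D.card ≤ (D.biUnion t).card := by
    intro D
    have hD : (D.card : ℝ) - 1 < ∑ j ∈ D, ∑ i, x i j := by
      rw [amount, Finset.sum_comm, ← Finset.sum_add_sum_compl D] at hn
      have h2 : ∑ j ∈ Dᶜ, ∑ i, x i j ≤ Dᶜ.card := by
        simpa using Finset.sum_le_sum fun j (_ : j ∈ Dᶜ) => hx.job j
      have h3 : (D.card : ℝ) + Dᶜ.card = Fintype.card J := by
        exact_mod_cast Finset.card_add_card_compl D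
      linarith
    have hN : ∑ j ∈ D, ∑ i, x i j ≤ (D.biUnion t).card := by
      calc ∑ j ∈ D, ∑ i, x i j
          = ∑ j ∈ D, ∑ is : M × Fin (Fintype.card J), overlap ord x is.1 j is.2 := by
            refine Finset.sum_congr rfl fun j _ => ?_
            rw [Fintype.sum_prod_type]
            exact Finset.sum_congr rfl fun i _ =>
              (sum_overlap_slots hx.nonneg hx.le_one i j).symm
        _ = ∑ j ∈ D, ∑ is ∈ D.biUnion t, overlap ord x is.1 j is.2 := by
            refine Finset.sum_congr rfl fun j hj => (Finset.sum_subset (Finset.subset_univ _)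
              fun is _ his => ?_).symm
            refine le_antisymm (not_lt.1 fun hpos => his ?_) (overlap_nonneg hx.nonneg _ _ _)
            exact Finset.mem_biUnion.2 ⟨j, hj, by simpa [ht] using inSlot_of_overlap_pos hpos⟩
        _ = ∑ is ∈ D.biUnion t, ∑ j ∈ D, overlap ord x is.1 j is.2 := Finset.sum_comm
        _ ≤ ∑ is ∈ D.biUnion t, 1 := by
            refine Finset.sum_le_sum fun is _ => le_trans ?_
              (sum_overlap_jobs_le_one (ord := ord) (x := x) is.1 is.2)
            exact Finset.sum_le_sum_of_subset_of_nonneg (Finset.subset_univ _)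
              fun _ _ _ => overlap_nonneg hx.nonneg _ _ _
        _ = _ := by simp
    have h4 : (D.card : ℝ) < (D.biUnion t).card + 1 := by linarith
    exact Nat.lt_succ_iff.1 (by exact_mod_cast h4)
  obtain ⟨f, hf, hft⟩ := (Finset.all_card_le_biUnion_card_iff_exists_injective t).1 hall
  have hslot : ∀ j, InSlot ord x (f j).1 j (f j).2 := fun j => by simpa [ht] using hft j
  refine ⟨⟨S, fun j => (f j).1, fun j => ?_⟩, rfl, fun j => (f j).2, hslot, hf⟩
  by_contra hS
  exact (hslot j).pos.ne' (hx.inactive _ _ hS)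

theorem exists_isSortedOrder {M J : Type*} [Fintype J] (I : Problem M J) :
    ∃ ord, IsSortedOrder I ord := by
  -- list the jobs in any order, and sort them by the order dual of the processing time
  let e := Fintype.equivFin J
  let q : M → Fin (Fintype.card J) → ℝ≥0∞ᵒᵈ := fun i k => OrderDual.toDual (I.p i (e.symm k))
  refine ⟨fun i => e.trans (Tuple.sort (q i)).symm, fun i j j' h => ?_⟩
  have := Tuple.monotone_sort (q i) h
  simpa [q] using this

/-! ### The makespan of a rounding -/

theorem Feasible.le_of_pos (hx : Feasible I T S x) {i : M} {j : J} (h : 0 < x i j) :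
    I.p i j ≤ T :=
  not_lt.1 fun hlt => h.ne' (hx.too_long i j hlt)

/-- A job in slot `s + 1` takes at most the average, over slot `s`, of the processing times of the
jobs there. -/
theorem Feasible.toReal_le_sum_overlap (hx : Feasible I T S x)
    {ord : M → J ≃ Fin (Fintype.card J)} (hord : IsSortedOrder I ord) {i : M} {j : J} {s : ℕ}
    (h : InSlot ord x i j (s + 1)) :
    (I.p i j).toReal ≤ ∑ j', (I.p i j').toReal * overlap ord x i j' s := by
  calc (I.p i j).toReal
      = ∑ j' with (ord i j' : ℕ) < ord i j + 1, (I.p i j).toReal * overlap ord x i j' s := by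
        rw [← Finset.mul_sum, h.sum_overlap_eq_one, mul_one]
    _ ≤ ∑ j' with (ord i j' : ℕ) < ord i j + 1, (I.p i j').toReal * overlap ord x i j' s := by
        refine Finset.sum_le_sum fun j' hj' => ?_
        rcases (overlap_nonneg hx.nonneg i j' s).eq_or_lt with h0 | hpos
        · rw [← h0, mul_zero, mul_zero]
        · have hle := hord i j' j (Fin.le_def.2
            (Nat.lt_succ_iff.1 (Finset.mem_filter.1 hj').2))
          have hfin := hx.le_of_pos (inSlot_of_overlap_pos hpos).pos
          exact mul_le_mul_of_nonneg_right
            (ENNReal.toReal_mono (ne_top_of_le_ne_top ENNReal.coe_ne_top hfin) hle) hpos.le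
    _ ≤ _ := Finset.sum_le_sum_of_subset_of_nonneg (Finset.subset_univ _)
        fun _ _ _ => mul_nonneg ENNReal.toReal_nonneg (overlap_nonneg hx.nonneg _ _ _)

variable [DecidableEq M]

/-- The job in the first slot takes at most `T`; the job in any later slot is charged to the
fractional load of the preceding slot, and these loads add up to at most `T`. -/
theorem Feasible.sum_toReal_le (hx : Feasible I T S x) {ord : M → J ≃ Fin (Fintype.card J)}
    (hord : IsSortedOrder I ord) {σ : J → M} (hσ : IsRounding ord x σ) (i : M) :
    ∑ j with σ j = i, (I.p i j).toReal ≤ 2 * T := by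
  classical
  obtain ⟨slot, hslot, hinj⟩ := hσ
  have hinj' : ∀ j, σ j = i → ∀ j', σ j' = i → (slot j : ℕ) = slot j' → j = j' :=
    fun j hj j' hj' h => hinj (Prod.ext (hj.trans hj'.symm) (Fin.ext h))
  have hslot' : ∀ j, σ j = i → InSlot ord x i j (slot j) := fun j hj => hj ▸ hslot j
  set q : ℕ → ℝ := fun s => ∑ j', (I.p i j').toReal * overlap ord x i j' s with hq
  have hq0 : ∀ s, 0 ≤ q s := fun s => Finset.sum_nonneg fun j' _ =>
    mul_nonneg ENNReal.toReal_nonneg (overlap_nonneg hx.nonneg _ _ _)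
  have hfirst : ∑ j ∈ {j | σ j = i} with (slot j : ℕ) = 0, (I.p i j).toReal ≤ T := by
    set D := ({j | σ j = i} : Finset J).filter fun j => (slot j : ℕ) = 0
    have hcard : D.card ≤ 1 := Finset.card_le_one.2 fun j hj j' hj' => by
      simp only [D, Finset.mem_filter, Finset.mem_univ, true_and] at hj hj'
      exact hinj' j hj.1 j' hj'.1 (hj.2.trans hj'.2.symm)
    have hb : ∀ j ∈ D, (I.p i j).toReal ≤ T := fun j hj => by
      simp only [D, Finset.mem_filter, Finset.mem_univ, true_and] at hj
      exact ENNReal.toReal_mono ENNReal.coe_ne_top (hx.le_of_pos (hslot' j hj.1).pos)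
    refine (Finset.sum_le_card_nsmul D _ _ hb).trans ?_
    rw [nsmul_eq_mul]
    exact mul_le_of_le_one_left T.2 (by exact_mod_cast hcard)
  have hrest : ∑ j ∈ {j | σ j = i} with ¬ (slot j : ℕ) = 0, (I.p i j).toReal ≤ T := by
    set D := ({j | σ j = i} : Finset J).filter fun j => ¬ (slot j : ℕ) = 0
    have hD : ∀ j ∈ D, σ j = i ∧ (slot j : ℕ) ≠ 0 := fun j hj => by
      simpa [D] using hj
    have hDinj : Set.InjOn (fun j => (slot j : ℕ) - 1) D := fun j hj j' hj' h => by
      have h1 := hD j hj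
      have h2 := hD j' hj'
      refine hinj' j h1.1 j' h2.1 ?_
      dsimp only at h
      omega
    calc ∑ j ∈ D, (I.p i j).toReal ≤ ∑ j ∈ D, q ((slot j : ℕ) - 1) := by
          refine Finset.sum_le_sum fun j hj => hx.toReal_le_sum_overlap hord ?_
          rw [Nat.sub_add_cancel (Nat.one_le_iff_ne_zero.2 (hD j hj).2)]
          exact hslot' j (hD j hj).1
      _ = ∑ s ∈ D.image fun j => (slot j : ℕ) - 1, q s := (Finset.sum_image hDinj).symm
      _ ≤ ∑ s ∈ Finset.range (Fintype.card J), q s := by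
          refine Finset.sum_le_sum_of_subset_of_nonneg (fun s hs => ?_) fun s _ _ => hq0 s
          obtain ⟨j, -, rfl⟩ := Finset.mem_image.1 hs
          exact Finset.mem_range.2 ((Nat.sub_le _ _).trans_lt (slot j).2)
      _ = ∑ j', (I.p i j').toReal * x i j' := by
          rw [Finset.sum_comm]
          refine Finset.sum_congr rfl fun j' _ => ?_
          rw [← Finset.mul_sum, ← Fin.sum_univ_eq_sum_range (fun s => overlap ord x i j' s),
            sum_overlap_slots hx.nonneg hx.le_one]
      _ ≤ T := hx.machine i
  rw [← Finset.sum_filter_add_sum_filter_not _ fun j => (slot j : ℕ) = 0]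
  linarith

theorem Feasible.makespan_le (hx : Feasible I T S x) {ord : M → J ≃ Fin (Fintype.card J)}
    (hord : IsSortedOrder I ord) {s : Schedule M J} (hs : IsRounding ord x s.assign) :
    s.makespan I ≤ 2 * T := by
  refine iSup_le fun i => ?_
  have hfin : ∀ j ∈ ({j | s.assign j = i} : Finset J), I.p i j ≠ ∞ := fun j hj => by
    obtain ⟨slot, hslot, -⟩ := hs
    obtain rfl := (Finset.mem_filter.1 hj).2
    exact ne_top_of_le_ne_top ENNReal.coe_ne_top (hx.le_of_pos (hslot j).pos)
  have h := hx.sum_toReal_le hord hs i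
  rw [← ENNReal.toReal_sum hfin] at h
  rw [Schedule.load, ← ENNReal.ofReal_toReal (ENNReal.sum_ne_top.2 hfin)]
  refine (ENNReal.ofReal_le_ofReal h).trans ?_
  rw [ENNReal.ofReal_mul zero_le_two]
  simp

end MachineActivation

theorem mainTheorem3 {M J : Type*} [Fintype M] [Fintype J] [DecidableEq M]
    (I : MachineActivation.Problem M J) (T : ℝ≥0) (A : ℝ)
    (hopt : ∃ s : MachineActivation.Schedule M J, s.makespan I ≤ T ∧ s.cost I ≤ A) :
    -- the algorithm can produce an output
    (∃ s k c, MachineActivation.Outputs I T s k c) ∧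
    -- it never gets stuck before it is done
    (∀ S k c, MachineActivation.Reaches I T S k c → ¬ MachineActivation.Done I T S →
      ∃ i, MachineActivation.IsGreedyChoice I T S i) ∧
    -- it makes at most `min m n` greedy steps, the `i`-th of which solves `m - (i - 1)` linear programs
    (∀ S k c, MachineActivation.Reaches I T S k c →
      k ≤ min (Fintype.card M) (Fintype.card J) ∧
      c = ∑ i ∈ Finset.Icc 1 k, (Fintype.card M - (i - 1))) ∧
    -- when it is done, every optimal fractional assignment can be rounded to a schedule
    (∀ S k c, MachineActivation.Reaches I T S k c → MachineActivation.Done I T S →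
      ∀ x, MachineActivation.IsOptimal I T S x →
      ∀ ord, MachineActivation.IsSortedOrder I ord →
      ∃ s : MachineActivation.Schedule M J, s.active = S ∧
        MachineActivation.IsRounding ord x s.assign) ∧
    -- every output has makespan at most `2 T` and activation cost at most `A (1 + ln n)`
    (∀ s k c, MachineActivation.Outputs I T s k c →
      s.makespan I ≤ 2 * T ∧ s.cost I ≤ A * (1 + Real.log (Fintype.card J))) := by
  obtain ⟨s₀, hs, hA⟩ := hopt
  have hround : ∀ S k c, MachineActivation.Reaches I T S k c → MachineActivation.Done I T S →
      ∀ x, MachineActivation.IsOptimal I T S x →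
      ∀ ord, MachineActivation.IsSortedOrder I ord →
      ∃ s : MachineActivation.Schedule M J, s.active = S ∧
        MachineActivation.IsRounding ord x s.assign := fun S k c _ hD x hx ord _ =>
    hx.1.exists_isRounding (by rwa [← MachineActivation.lpValue_eq I T S x hx]) ord
  refine ⟨?_, fun S k c _ hD => MachineActivation.exists_isGreedyChoice hs hD,
    fun S k c h => ⟨h.steps_le, h.lpCount_eq⟩, hround, ?_⟩
  · obtain ⟨S, k, c, h, hD⟩ := MachineActivation.exists_reaches_done hs
    obtain ⟨x, hx⟩ := MachineActivation.exists_isOptimal I T S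
    obtain ⟨ord, hord⟩ := MachineActivation.exists_isSortedOrder I
    obtain ⟨s, rfl, hs'⟩ := hround S k c h hD x hx ord hord
    exact ⟨s, k, c, h, hD, x, hx, ord, hord, hs'⟩
  · rintro s k c ⟨h, -, x, hx, ord, hord, hs'⟩
    exact ⟨hx.1.makespan_le hord hs', (h.cost_le hs hA).2⟩
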